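/- Let $\Gamma$ be a finite simplicial graph whose edges $e$ are labelled by arbitrary integers $m_e\ge 2$, and let $$A_\Gamma=\langle V(\Gamma)\mid \langle v,w\rangle^{m_e}=\langle w,v\rangle^{m_e}\text{ for every edge } e=\{v,w\}\rangle$$ be the associated Artin group, where $\langle v,w\rangle^{m}=vwv\cdots$ denotes the alternating product of length $m$ starting with $v$. If $\Gamma$ is a tree, then $A_\Gamma$ is normally poly-free, i.e. there is a finite chain of subgroups $1=G_0\le G_1\le\cdots\le G_n=A_\Gamma$ such that each $G_i$ is normal in $A_\Gamma$ and each quotient $G_i/G_{i-1}$ ($1\le i\le n$) is a free group of possibly infinite rank. -/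

import Mathlib

/-- The alternating product `⟨a, b⟩^m = a b a ⋯` with exactly `m` factors, starting with `a`. -/
def altProd {M : Type*} [Monoid M] : M → M → ℕ → M
  | _, _, 0 => 1
  | a, b, m + 1 => a * altProd b a m

/-- The relators `⟨v, w⟩^m (⟨w, v⟩^m)⁻¹`, one for each ordered pair `(v, w)` of adjacent vertices,
where `m` is the label of the edge joining `v` and `w`. -/
def artinRelators {V : Type*} (Γ : SimpleGraph V) (m : Γ.edgeSet → ℕ) : Set (FreeGroup V) :=
  {r | ∃ (v w : V) (h : Γ.Adj v w),
    r = altProd (FreeGroup.of v) (FreeGroup.of w) (m ⟨s(v, w), h⟩) *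
      (altProd (FreeGroup.of w) (FreeGroup.of v) (m ⟨s(v, w), h⟩))⁻¹}

/-- The Artin group of the graph `Γ` with edges labelled by `m`: generators are the vertices,
with the relation `⟨v, w⟩^{m_e} = ⟨w, v⟩^{m_e}` for each edge `e = {v, w}`. -/
abbrev ArtinGroup {V : Type*} (Γ : SimpleGraph V) (m : Γ.edgeSet → ℕ) : Type _ :=
  PresentedGroup (artinRelators Γ m)

/-- A group `G` is normally poly-free if there is a finite chain of subgroups
`1 = G₀ ≤ G₁ ≤ ⋯ ≤ Gₙ = G`, each normal in `G`, whose successive quotients `Gᵢ₊₁ / Gᵢ` are free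
groups (of possibly infinite rank). -/
def IsNormallyPolyFree (G : Type*) [Group G] : Prop :=
  ∃ (n : ℕ) (H : Fin (n + 1) → Subgroup G) (_ : ∀ i, (H i).Normal),
    H 0 = ⊥ ∧ H (Fin.last n) = ⊤ ∧
      ∀ i : Fin n, H i.castSucc ≤ H i.succ ∧
        IsFreeGroup (H i.succ ⧸ (H i.castSucc).subgroupOf (H i.succ))

/-! The kernel of the exponent sum `A_Γ → ℤ` is free, so it gives a chain of length two. Induct by
removing a leaf `v` attached to `w`: `A_Γ` is the amalgam of the smaller group `G` and a dihedral
Artin group along `⟨w⟩`, on which the exponent sum is injective. Writing both factors as (free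
kernel) ⋊ `⟨w⟩` turns the amalgam into (free product of the kernels) ⋊ `ℤ`, which is
`LeafExtension`. It is enough to embed `A_Γ` there over `ℤ`: `exists_lift` supplies a left inverse,
and subgroups of free groups are free. The dihedral group is handled through atoms `c i`, `i : ZMod
m`, all of whose products `c i * c (i + 1)` equal one element `δ`. -/

open Monoid.Coprod in
/-- A free product of two free groups is free. -/
theorem IsFreeGroup.coprod (G H : Type*) [Group G] [Group H] [IsFreeGroup G] [IsFreeGroup H] :
    IsFreeGroup (Monoid.Coprod G H) := by
  let e : FreeGroup (Generators G ⊕ Generators H) ≃*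
      Monoid.Coprod (FreeGroup (Generators G)) (FreeGroup (Generators H)) :=
    MonoidHom.toMulEquiv
      (FreeGroup.lift (Sum.elim (fun x => inl (FreeGroup.of x)) (fun y => inr (FreeGroup.of y))))
      (Monoid.Coprod.lift (FreeGroup.map Sum.inl) (FreeGroup.map Sum.inr))
      (by ext (x | y) <;> simp)
      (by ext <;> simp)
  exact IsFreeGroup.ofMulEquiv
    (e.trans (MulEquiv.coprodCongr (IsFreeGroup.mulEquiv G) (IsFreeGroup.mulEquiv H)))

/-- A group that embeds in a free group is free. -/
theorem IsFreeGroup.of_injective {G H : Type*} [Group G] [Group H] [IsFreeGroup H] (f : G →* H)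
    (hf : Function.Injective f) : IsFreeGroup G :=
  -- The range is free by Nielsen–Schreier.
  IsFreeGroup.ofMulEquiv (f.ofInjective hf).symm

/-! ### Dihedral Artin relations and cyclic families of atoms -/

section AltProd

theorem map_altProd {M N : Type*} [Monoid M] [Monoid N] (f : M →* N) (a b : M) (m : ℕ) :
    f (altProd a b m) = altProd (f a) (f b) m := by
  induction m generalizing a b with
  | zero => simp [altProd]
  | succ m ih => simp [altProd, ih]

theorem altProd_two_mul {M : Type*} [Monoid M] (a b : M) (k : ℕ) :
    altProd a b (2 * k) = (a * b) ^ k := by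
  induction k with
  | zero => simp [altProd]
  | succ k ih => rw [Nat.mul_succ, altProd, altProd, ih, pow_succ', mul_assoc]

theorem altProd_two_mul_add_one {M : Type*} [Monoid M] (a b : M) (k : ℕ) :
    altProd a b (2 * k + 1) = (a * b) ^ k * a := by
  rw [altProd, altProd_two_mul, mul_pow_mul]

variable {G : Type*} [Group G]

/-- The two atoms `c 0` and `c 1` of a cyclic family whose consecutive products agree satisfy the
dihedral Artin relation. -/
theorem altProd_comm_of_mul_eq {m : ℕ} (c : ZMod m → G) (δ : G)
    (hc : ∀ i, c i * c (i + 1) = δ) : altProd (c 0) (c 1) m = altProd (c 1) (c 0) m := by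
  have h01 : c 0 * c 1 = δ := by simpa using hc 0
  -- Moving an atom past `δ` shifts its index by 2, since `c i * c (i + 1) * c (i + 2)` can be
  -- bracketed in two ways.
  have hshift (i : ZMod m) (k : ℕ) : c i * δ ^ k = δ ^ k * c (i + 2 * k) := by
    induction k generalizing i with
    | zero => simp
    | succ k ih =>
      have h2 : c i * δ = δ * c (i + 2) := by
        rw [← hc (i + 1), ← mul_assoc, hc, hc, add_assoc, one_add_one_eq_two]
      rw [pow_succ', ← mul_assoc, h2, mul_assoc, ih, mul_assoc]
      congr 3
      push_cast
      ring
  obtain ⟨k, rfl | rfl⟩ := Nat.even_or_odd' m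
  · rw [altProd_two_mul, altProd_two_mul, h01]
    have h := hshift 1 k
    rw [show (1 + 2 * k : ZMod (2 * k)) = 1 by
      have := ZMod.natCast_self (2 * k); push_cast at this; rw [this, add_zero]] at h
    rw [← mul_left_inj (c 1), ← h, mul_pow_mul, h01]
  · rw [altProd_two_mul_add_one, altProd_two_mul_add_one, h01, mul_pow_mul, h01, hshift]
    congr 2
    have := ZMod.natCast_self (2 * k + 1)
    push_cast at this
    rw [add_comm 1, this]

/-- Two elements that satisfy the dihedral Artin relation of length `m` extend to a family indexed
by `ZMod m` whose consecutive products agree. -/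
theorem exists_zmod_mul_eq {m : ℕ} (hm : 2 ≤ m) (x y : G)
    (h : altProd x y m = altProd y x m) :
    ∃ c : ZMod m → G, c 0 = x ∧ c 1 = y ∧ ∀ i, c i * c (i + 1) = x * y := by
  -- The product condition forces this recursion; the dihedral relation then says exactly that `d m
  -- = d 0`, so the sequence descends to `ZMod m`.
  obtain ⟨d, d0, hd⟩ : ∃ d : ℕ → G, d 0 = x ∧ ∀ n, d (n + 1) = (d n)⁻¹ * (x * y) :=
    ⟨fun n => Nat.rec x (fun _ z => z⁻¹ * (x * y)) n, rfl, fun _ => rfl⟩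
  have d1 : d 1 = y := by rw [← zero_add 1, hd, d0, inv_mul_cancel_left]
  have hshift (i k : ℕ) : d i * (x * y) ^ k = (x * y) ^ k * d (i + 2 * k) := by
    induction k generalizing i with
    | zero => simp
    | succ k ih =>
      have h2 : d i * (x * y) = x * y * d (i + 2) := by
        rw [hd (i + 1), hd i]; group
      rw [pow_succ', ← mul_assoc, h2, mul_assoc, ih, mul_assoc,
        show i + 2 + 2 * k = i + 2 * (k + 1) by ring]
      simp only [mul_assoc]
  have hdm : d m = x := by
    obtain ⟨k, rfl | rfl⟩ := Nat.even_or_odd' m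
    · rw [altProd_two_mul, altProd_two_mul] at h
      have h' := hshift 0 k
      rw [d0, zero_add] at h'
      rw [← mul_right_inj ((x * y) ^ k), ← h', mul_pow_mul, h]
    · rw [altProd_two_mul_add_one, altProd_two_mul_add_one, mul_pow_mul y] at h
      have h' := hshift 1 k
      rw [d1, ← h, mul_right_inj] at h'
      rw [add_comm, ← h']
  have hper : Function.Periodic d m := by
    intro n
    induction n with
    | zero => rw [zero_add, hdm, d0]
    | succ n ih => rw [add_right_comm, hd, hd, ih]
  have : NeZero m := ⟨by omega⟩
  have : Fact (1 < m) := ⟨hm⟩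
  refine ⟨fun i => d i.val, by simp [d0], by simp [ZMod.val_one, d1], fun i => ?_⟩
  simp only
  rw [ZMod.val_add, ZMod.val_one, hper.map_mod_nat, hd, mul_inv_cancel_left]

end AltProd

/-! ### The free kernel of a dihedral Artin group and its monodromy -/

section DihedralFiber

/-- The free group on the nonzero elements of `ZMod m`: the kernel of the exponent sum map on the
dihedral Artin group of length `m`. -/
abbrev DihedralFiber (m : ℕ) : Type := FreeGroup {i : ZMod m // i ≠ 0}

variable {m : ℕ}

namespace DihedralFiber

open Classical in
/-- The generator with index `i`, understood to be trivial for `i = 0`. -/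
noncomputable def gen (i : ZMod m) : DihedralFiber m :=
  if h : i = 0 then 1 else FreeGroup.of ⟨i, h⟩

@[simp] theorem gen_zero : gen (0 : ZMod m) = 1 := by simp [gen]

theorem gen_coe (i : {i : ZMod m // i ≠ 0}) : gen (i : ZMod m) = FreeGroup.of i := by
  simp [gen, i.2]

variable {K : Type*} [Group K]

theorem hom_ext {f g : DihedralFiber m →* K} (h : ∀ i, f (gen i) = g (gen i)) : f = g :=
  FreeGroup.ext_hom _ _ fun i => by simpa only [gen_coe] using h i

/-- The homomorphism given by its values on `gen i`. -/
def lift (c : ZMod m → K) : DihedralFiber m →* K := FreeGroup.lift fun i => c i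

theorem lift_gen (c : ZMod m → K) (hc : c 0 = 1) (i : ZMod m) : lift c (gen i) = c i := by
  by_cases h : i = 0
  · simp [h, hc]
  · simp [lift, gen, h]

/-- The monodromy: conjugation by the atom with index `0`. -/
noncomputable def monodromy (m : ℕ) : MulAut (DihedralFiber m) :=
  MonoidHom.toMulEquiv
    -- Here `gen i` stands for `c i * (c 0)⁻¹`; the formula is conjugation by `c 0`, rewritten with
    -- `c (i - 1) * c i = c (-1) * c 0`.
    (lift fun i => (gen (i - 1))⁻¹ * gen (-1))
    (lift fun i => gen 1 * (gen (i + 1))⁻¹)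
    (hom_ext fun i => by
      simp [lift_gen])
    (hom_ext fun i => by
      simp [lift_gen])

theorem monodromy_gen (i : ZMod m) :
    monodromy m (gen i) = (gen (i - 1))⁻¹ * gen (-1) :=
  lift_gen (fun i => (gen (i - 1))⁻¹ * gen (-1)) (by simp) i

end DihedralFiber

end DihedralFiber

/-- Componentwise action of pairs of automorphisms on a free product. -/
def coprodMulAut (M N : Type*) [Group M] [Group N] :
    MulAut M × MulAut N →* MulAut (Monoid.Coprod M N) where
  toFun e := MulEquiv.coprodCongr e.1 e.2
  map_one' := MulEquiv.toMonoidHom_injective (Monoid.Coprod.hom_ext rfl rfl)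
  map_mul' _ _ := MulEquiv.toMonoidHom_injective (Monoid.Coprod.hom_ext rfl rfl)

/-! ### Amalgamation with a dihedral Artin group -/

section AdjoinLeaf

variable {G : Type*} [Group G] (φ : G →* Multiplicative ℤ) (w : G) (m : ℕ)

/-- The action of `ℤ` on `φ.ker ∗ DihedralFiber m`, by conjugation by `w` on the first factor and by
the monodromy on the second one. -/
noncomputable def leafAction :
    Multiplicative ℤ →* MulAut (Monoid.Coprod φ.ker (DihedralFiber m)) :=
  (coprodMulAut _ _).comp
    ((MulAut.conjNormal.comp (zpowersHom G w)).prod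
      (zpowersHom _ (DihedralFiber.monodromy m)))

/-- The group obtained from `G` by adjoining an element that satisfies the dihedral Artin relation
of length `m` with `w`, as an extension of `ℤ` by a free product. -/
abbrev LeafExtension : Type _ :=
  Monoid.Coprod φ.ker (DihedralFiber m) ⋊[leafAction φ w m] Multiplicative ℤ

theorem leafAction_inl (n : Multiplicative ℤ) (x : φ.ker) :
    leafAction φ w m n (Monoid.Coprod.inl x) =
      Monoid.Coprod.inl (MulAut.conjNormal (w ^ n.toAdd) x) := rfl

theorem leafAction_inr (n : Multiplicative ℤ) (x : DihedralFiber m) :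
    leafAction φ w m n (Monoid.Coprod.inr x) =
      Monoid.Coprod.inr ((DihedralFiber.monodromy m ^ n.toAdd) x) := rfl

namespace LeafExtension

variable {φ w}

/-- The inclusion of the original group. -/
noncomputable def ofBase (hw : φ w = Multiplicative.ofAdd 1) : G →* LeafExtension φ w m where
  -- Since `φ w` generates `ℤ`, `G` splits as `φ.ker ⋊ ⟨w⟩`.
  toFun g := ⟨Monoid.Coprod.inl ⟨g * w ^ (-(φ g).toAdd), by
    rw [MonoidHom.mem_ker, map_mul, map_zpow, hw, ← ofAdd_zsmul]
    simp⟩, φ g⟩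
  map_one' := by
    ext
    · simp only [SemidirectProduct.one_left]
      rw [← map_one Monoid.Coprod.inl]
      congr 1
      ext
      simp
    · simp
  map_mul' g h := by
    ext
    · simp only [SemidirectProduct.mul_left]
      rw [leafAction_inl]
      refine Eq.trans ?_ (map_mul Monoid.Coprod.inl _ _)
      congr 1
      ext
      simp only [map_mul, toAdd_mul, Subgroup.coe_mul, MulAut.conjNormal_apply]
      group
    · simp

/-- The atom with index `i`. -/
noncomputable def atom (φ : G →* Multiplicative ℤ) (w : G) {m : ℕ} (i : ZMod m) :
    LeafExtension φ w m :=
  ⟨Monoid.Coprod.inr (DihedralFiber.gen i), Multiplicative.ofAdd 1⟩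

theorem atom_mul (i : ZMod m) :
    atom φ w i * atom φ w (i + 1) =
      ⟨Monoid.Coprod.inr (DihedralFiber.gen (-1)), Multiplicative.ofAdd 2⟩ := by
  ext
  · simp only [atom, SemidirectProduct.mul_left]
    rw [leafAction_inr, toAdd_ofAdd, zpow_one, DihedralFiber.monodromy_gen, ← map_mul]
    simp
  · rfl

/-- This is the gluing: both elements are the generator of the factor `ℤ`. -/
theorem ofBase_self (hw : φ w = Multiplicative.ofAdd 1) : ofBase m hw w = atom φ w 0 := by
  ext
  · simp only [atom, ofBase, MonoidHom.coe_mk, OneHom.coe_mk, DihedralFiber.gen_zero]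
    rw [map_one, ← map_one Monoid.Coprod.inl]
    congr 1
    ext
    simp [hw]
  · exact hw

variable {m}

theorem altProd_atom (hw : φ w = Multiplicative.ofAdd 1) :
    altProd (ofBase m hw w) (atom φ w 1) m = altProd (atom φ w 1) (ofBase m hw w) m := by
  rw [ofBase_self]
  exact altProd_comm_of_mul_eq (atom φ w) _ (atom_mul m)

/-- The existence half of the universal property of the amalgam. The elements `j w` and `v` generate
a cyclic family of atoms in `K`, which prescribes the map on the dihedral fiber; uniqueness is not
needed. -/
theorem exists_lift (hw : φ w = Multiplicative.ofAdd 1) (hm : 2 ≤ m) {K : Type*} [Group K]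
    (j : G →* K) (v : K) (hv : altProd (j w) v m = altProd v (j w) m) :
    ∃ ρ : LeafExtension φ w m →* K, ρ.comp (ofBase m hw) = j ∧ ρ (atom φ w 1) = v := by
  obtain ⟨c, c0, c1, hc⟩ := exists_zmod_mul_eq hm (j w) v hv
  let fn : Monoid.Coprod φ.ker (DihedralFiber m) →* K :=
    Monoid.Coprod.lift (j.comp φ.ker.subtype) (DihedralFiber.lift fun i => c i * (j w)⁻¹)
  have hgen (i : ZMod m) :
      DihedralFiber.lift (fun i => c i * (j w)⁻¹) (DihedralFiber.gen i) = c i * (j w)⁻¹ :=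
    DihedralFiber.lift_gen _ (by simp [c0]) i
  -- Equivariance under the generator of `ℤ`; on the dihedral factor it amounts to `c (i - 1) * c i
  -- = c (-1) * c 0`.
  have hone : fn.comp (leafAction φ w m (Multiplicative.ofAdd 1)).toMonoidHom =
      (MulAut.conj (j w)).toMonoidHom.comp fn := by
    refine Monoid.Coprod.hom_ext ?_ (DihedralFiber.hom_ext fun i => ?_)
    · ext x
      simp [fn, leafAction_inl]
    · have h1 := hc (i - 1)
      have h2 := hc (-1)
      rw [sub_add_cancel] at h1
      rw [neg_add_cancel, c0, ← h1] at h2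
      have h3 : (c (i - 1))⁻¹ * c (-1) = c i * (j w)⁻¹ := by
        rw [inv_mul_eq_iff_eq_mul, ← mul_assoc, ← h2, mul_inv_cancel_right]
      simp only [MonoidHom.comp_apply, MulEquiv.toMonoidHom_eq_coe, MonoidHom.coe_coe,
        leafAction_inr, toAdd_ofAdd, zpow_one, DihedralFiber.monodromy_gen, fn,
        Monoid.Coprod.lift_apply_inr, map_mul, map_inv, hgen, MulAut.conj_apply]
      rw [mul_inv_rev, inv_inv, mul_assoc, ← mul_assoc (c _)⁻¹, h3]
      group
  have hall (n : Multiplicative ℤ) : fn.comp (leafAction φ w m n).toMonoidHom =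
      (MulAut.conj (zpowersHom K (j w) n)).toMonoidHom.comp fn := by
    have key : ∀ n : ℤ, ∀ x, fn ((leafAction φ w m (Multiplicative.ofAdd 1) ^ n) x) =
        j w ^ n * fn x * (j w ^ n)⁻¹ := by
      have h1 (x) : fn (leafAction φ w m (Multiplicative.ofAdd 1) x) = j w * fn x * (j w)⁻¹ :=
        DFunLike.congr_fun hone x
      intro n
      induction n with
      | zero => simp
      | succ n ih =>
        intro x
        rw [zpow_add_one, MulAut.mul_apply, ih, h1, zpow_add_one]
        group
      | pred n ih =>
        intro x
        rw [zpow_sub_one, MulAut.mul_apply, ih, zpow_sub_one]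
        have h2 := h1 ((leafAction φ w m (Multiplicative.ofAdd 1))⁻¹ x)
        rw [MulAut.apply_inv_self] at h2
        rw [h2]
        group
    refine MonoidHom.ext fun x => ?_
    have := key n.toAdd x
    rw [← map_zpow, ← ofAdd_zsmul, smul_eq_mul, mul_one, ofAdd_toAdd] at this
    exact this
  refine ⟨SemidirectProduct.lift fn (zpowersHom K (j w)) hall, ?_, ?_⟩
  · ext g
    simp [SemidirectProduct.lift, ofBase, fn]
  · simp [SemidirectProduct.lift, atom, fn, hgen, c1]

/-- The exponent sum map has free kernel if the one on the original group has. -/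
theorem isFreeGroup_ker_rightHom [IsFreeGroup φ.ker] :
    IsFreeGroup (SemidirectProduct.rightHom : LeafExtension φ w m →* _).ker := by
  have := IsFreeGroup.coprod φ.ker (DihedralFiber m)
  rw [← SemidirectProduct.range_inl_eq_ker_rightHom]
  exact IsFreeGroup.ofMulEquiv (MonoidHom.ofInjective SemidirectProduct.inl_injective)

end LeafExtension

end AdjoinLeaf

/-! ### Exponent sums on Artin groups and induction over leaves -/

section ArtinGroup

variable {V : Type*} {Γ : SimpleGraph V} {m : Γ.edgeSet → ℕ}

namespace ArtinGroup

/-- The generator of the Artin group that belongs to a vertex. -/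
def of (m : Γ.edgeSet → ℕ) (v : V) : ArtinGroup Γ m := PresentedGroup.of v

theorem altProd_of {v w : V} (h : Γ.Adj v w) :
    altProd (of m v) (of m w) (m ⟨s(v, w), h⟩) = altProd (of m w) (of m v) (m ⟨s(v, w), h⟩) := by
  have := PresentedGroup.mk_eq_mk_of_mul_inv_mem (rels := artinRelators Γ m) ⟨v, w, h, rfl⟩
  rwa [map_altProd, map_altProd] at this

/-- The homomorphism given by elements that satisfy the Artin relations. -/
def lift {K : Type*} [Group K] (f : V → K)
    (hf : ∀ v w (h : Γ.Adj v w), altProd (f v) (f w) (m ⟨s(v, w), h⟩) =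
      altProd (f w) (f v) (m ⟨s(v, w), h⟩)) : ArtinGroup Γ m →* K :=
  PresentedGroup.toGroup (f := f) (by
    rintro _ ⟨v, w, h, rfl⟩
    rw [map_mul, map_inv, map_altProd, map_altProd, mul_inv_eq_one]
    simpa using hf v w h)

@[simp] theorem lift_of {K : Type*} [Group K] (f : V → K)
    (hf : ∀ v w (h : Γ.Adj v w), altProd (f v) (f w) (m ⟨s(v, w), h⟩) =
      altProd (f w) (f v) (m ⟨s(v, w), h⟩)) (v : V) : lift f hf (of m v) = f v :=
  PresentedGroup.toGroup.of _

theorem hom_ext {K : Type*} [Group K] {f g : ArtinGroup Γ m →* K}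
    (h : ∀ v, f (of m v) = g (of m v)) : f = g :=
  PresentedGroup.ext h

/-- The exponent sum map, which sends every generator to `1 ∈ ℤ`. -/
def exponentSum (m : Γ.edgeSet → ℕ) : ArtinGroup Γ m →* Multiplicative ℤ :=
  lift (fun _ => Multiplicative.ofAdd 1) fun _ _ _ => rfl

@[simp] theorem exponentSum_of (v : V) : exponentSum m (of m v) = Multiplicative.ofAdd 1 :=
  lift_of _ _ v

theorem isFreeGroup_ker_exponentSum_of_subsingleton [Subsingleton V] [Nonempty V] :
    IsFreeGroup (exponentSum m).ker := by
  obtain ⟨v⟩ := ‹Nonempty V›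
  have h : (zpowersHom _ (of m v)).comp (exponentSum m) = MonoidHom.id _ :=
    hom_ext fun u => by simp [Subsingleton.elim u v]
  have hinj : Function.Injective (exponentSum m) :=
    Function.LeftInverse.injective (g := zpowersHom _ (of m v)) (DFunLike.congr_fun h)
  rw [(MonoidHom.ker_eq_bot_iff _).2 hinj]
  exact IsFreeGroup.of_injective (H := FreeGroup Empty) 1
    (Function.injective_of_subsingleton _)

/-- The labels of an induced subgraph. -/
def induceLabels (m : Γ.edgeSet → ℕ) (s : Set V) : (Γ.induce s).edgeSet → ℕ :=
  fun e => m ((SimpleGraph.Embedding.induce s).mapEdgeSet e)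

/-- The map `ψ` to the leaf extension, with `v` going to atom 1, has left inverse `ρ` and respects
the maps to `ℤ`. Hence it embeds the kernel in a free group; surjectivity of `ψ` plays no role. -/
theorem isFreeGroup_ker_exponentSum_of_leaf (hm : ∀ e, 2 ≤ m e) {v w : V} (hvw : Γ.Adj v w)
    (huniq : ∀ u, Γ.Adj v u → u = w)
    (hfree : IsFreeGroup (exponentSum (induceLabels m {v}ᶜ)).ker) :
    IsFreeGroup (exponentSum m).ker := by
  classical
  let m' := induceLabels m {v}ᶜ
  let w' : ({v}ᶜ : Set V) := ⟨w, hvw.ne'⟩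
  let k := m ⟨s(v, w), hvw⟩
  have hw : exponentSum m' (of m' w') = Multiplicative.ofAdd 1 := exponentSum_of w'
  let ι := LeafExtension.ofBase k hw
  let a : LeafExtension (exponentSum m') (of m' w') k := LeafExtension.atom _ _ 1
  have ha : altProd (ι (of m' w')) a k = altProd a (ι (of m' w')) k :=
    LeafExtension.altProd_atom hw
  let f : V → LeafExtension (exponentSum m') (of m' w') k :=
    fun u => if h : u = v then a else ι (of m' ⟨u, h⟩)
  have fv : f v = a := by simp [f]
  have fne (u : V) (h : u ≠ v) : f u = ι (of m' ⟨u, h⟩) := by simp [f, h]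
  let ψ : ArtinGroup Γ m →* LeafExtension (exponentSum m') (of m' w') k := lift f <| by
    have hleaf (u : V) (h : Γ.Adj v u) : altProd (f v) (f u) (m ⟨s(v, u), h⟩) =
        altProd (f u) (f v) (m ⟨s(v, u), h⟩) := by
      obtain rfl := huniq u h
      rw [fv, fne u h.ne']
      exact ha.symm
    intro x y h
    by_cases hx : x = v
    · subst hx
      exact hleaf y h
    by_cases hy : y = v
    · subst hy
      have he : (⟨s(x, y), h⟩ : Γ.edgeSet) = ⟨s(y, x), h.symm⟩ := Subtype.ext Sym2.eq_swap
      rw [he]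
      exact (hleaf x h.symm).symm
    · rw [fne x hx, fne y hy, ← map_altProd, ← map_altProd]
      exact congrArg ι (altProd_of (m := m') (v := ⟨x, hx⟩) (w := ⟨y, hy⟩) h)
  let j : ArtinGroup (Γ.induce {v}ᶜ) m' →* ArtinGroup Γ m :=
    lift (fun u => of m u) fun _ _ h => altProd_of (m := m) h
  obtain ⟨ρ, hρ, hρa⟩ := LeafExtension.exists_lift hw (hm ⟨s(v, w), hvw⟩) j (of m v) (by
    rw [show j (of m' w') = of m w from lift_of _ _ _]
    exact (altProd_of hvw).symm)
  have hinv : ρ.comp ψ = MonoidHom.id _ := hom_ext fun u => by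
    rw [MonoidHom.comp_apply, lift_of, MonoidHom.id_apply]
    by_cases h : u = v
    · subst h
      rw [fv]
      exact hρa
    · rw [fne u h]
      exact (DFunLike.congr_fun hρ _).trans (lift_of _ _ _)
  have hψ : Function.Injective ψ := Function.LeftInverse.injective (DFunLike.congr_fun hinv)
  have hsum : SemidirectProduct.rightHom.comp ψ = exponentSum m := hom_ext fun u => by
    rw [MonoidHom.comp_apply, lift_of, exponentSum_of]
    by_cases h : u = v
    · subst h
      rw [fv]
      rfl
    · rw [fne u h]
      exact exponentSum_of (m := m') _
  have := LeafExtension.isFreeGroup_ker_rightHom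
    (φ := exponentSum m') (w := of m' w') (m := k)
  refine IsFreeGroup.of_injective ((ψ.comp (exponentSum m).ker.subtype).codRestrict
    (SemidirectProduct.rightHom : LeafExtension (exponentSum m') (of m' w') k →* _).ker
    fun x => ?_) fun x y hxy => ?_
  · rw [MonoidHom.mem_ker]
    exact (DFunLike.congr_fun hsum _).trans x.2
  · exact Subtype.ext (hψ (congrArg Subtype.val hxy))

/-- The Artin group of a tree is free-by-cyclic. -/
theorem isFreeGroup_ker_exponentSum [Finite V] (hm : ∀ e, 2 ≤ m e) (hΓ : Γ.IsTree) :
    IsFreeGroup (exponentSum m).ker := by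
  classical
  induction h : Nat.card V using Nat.strong_induction_on generalizing V with
  | _ n ih =>
    have := hΓ.connected.nonempty
    cases subsingleton_or_nontrivial V with
    | inl _ => exact isFreeGroup_ker_exponentSum_of_subsingleton
    | inr _ =>
      have := Fintype.ofFinite V
      obtain ⟨v, hv⟩ := hΓ.exists_vert_degree_one_of_nontrivial
      obtain ⟨w, hvw, huniq⟩ := SimpleGraph.degree_eq_one_iff_existsUnique_adj.1 hv
      refine isFreeGroup_ker_exponentSum_of_leaf hm hvw huniq (ih _ ?_ (fun e => hm _)
        ⟨hΓ.connected.induce_compl_singleton_of_degree_eq_one hv, hΓ.isAcyclic.induce _⟩ rfl)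
      rw [← h]
      exact Finite.card_subtype_lt (x := v) (by simp)

end ArtinGroup

end ArtinGroup

/-! ### From a free kernel to a normal chain -/

/-- A group with a homomorphism to a free group whose kernel is free is normally poly-free. -/
theorem IsNormallyPolyFree.of_isFreeGroup_ker {G F : Type*} [Group G] [Group F] [IsFreeGroup F]
    (φ : G →* F) (hφ : IsFreeGroup φ.ker) : IsNormallyPolyFree G := by
  refine ⟨2, ![⊥, φ.ker, ⊤], fun i => ?_, rfl, rfl, fun i => ?_⟩
  · fin_cases i
    · exact inferInstanceAs (⊥ : Subgroup G).Normal
    · exact inferInstanceAs φ.ker.Normal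
    · exact inferInstanceAs (⊤ : Subgroup G).Normal
  · fin_cases i
    · refine ⟨bot_le, ?_⟩
      change IsFreeGroup (φ.ker ⧸ (⊥ : Subgroup G).subgroupOf φ.ker)
      exact IsFreeGroup.ofMulEquiv (QuotientGroup.quotientBot.symm.trans
        (QuotientGroup.quotientMulEquivOfEq (Subgroup.bot_subgroupOf _).symm))
    · refine ⟨le_top, ?_⟩
      change IsFreeGroup ((⊤ : Subgroup G) ⧸ φ.ker.subgroupOf ⊤)
      -- The quotient embeds in `F`, so `φ` need not be surjective.
      exact IsFreeGroup.of_injective (QuotientGroup.kerLift (φ.comp (⊤ : Subgroup G).subtype))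
        (QuotientGroup.kerLift_injective _)

theorem isFreeGroup_multiplicative_int : IsFreeGroup (Multiplicative ℤ) :=
  IsFreeGroup.ofMulEquiv (MonoidHom.toMulEquiv
    (FreeGroup.lift fun _ : Unit => Multiplicative.ofAdd (1 : ℤ))
    (zpowersHom _ (FreeGroup.of ()))
    (by ext; simp) (by ext; simp))

theorem mainTheorem7 {V : Type*} [Finite V] (Γ : SimpleGraph V) (m : Γ.edgeSet → ℕ)
    (hm : ∀ e, 2 ≤ m e) (hΓ : Γ.IsTree) :
    IsNormallyPolyFree (ArtinGroup Γ m) := by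
  have := isFreeGroup_multiplicative_int
  exact IsNormallyPolyFree.of_isFreeGroup_ker _ (ArtinGroup.isFreeGroup_ker_exponentSum hm hΓ)
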